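/- Let $d\ge 1$, let $D\subset\mathbb R^d$ be a bounded open set, let $H^1_0=H^1_0(D)$ carry the inner product $\int_D\nabla u\cdot\nabla v\,d\xi$, and let $H=H^{-1}(D)$ be its dual with the dual norm and inner product. Identify $f\in L^2(D)$ with the functional $v\mapsto\int_D fv\,d\xi$ in $H$, and let $\Delta:H^1_0\to H$, $(\Delta u)(v)=-\int_D\nabla u\cdot\nabla v\,d\xi$, be the Dirichlet Laplacian. Assume: (H1) $C$ is a positive bounded operator of trace class on $H$, and $Ce_k=\lambda_ke_k$ with $\lambda_k\in[0,\infty)$ for all $k\in\mathbb N$, where $\{e_k : k\in\mathbb N\}\subset H^1_0$ is an orthonormal basis of $H$ consisting of eigenvectors of $\Delta$. (H2) $\sum_{k}\alpha_k\lambda_k<\infty$, where $\alpha_k=\sup_{\xi\in D}|e_k(\xi)|^2$. (H3) $\Psi\in C^1(\mathbb R)$ and there are $r\in(1,\infty)$ and $\kappa_0,\kappa_1,C_1>0$ with $\kappa_0|s|^{r-1}\le\Psi'(s)\le\kappa_1|s|^{r-1}+C_1$ for all $s\in\mathbb R$. Let $C^2_b(H)$ be the set of twice continuously Fréchet differentiable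 functions $\varphi:H\to\mathbb R$ such that $\varphi$, $D\varphi$ and $D^2\varphi$ are bounded. Let $H_\Psi=\{x\in L^2(D):\Psi(x)\in H^1_0\}\subset H$, and for $\varphi\in C^2_b(H)$ and $x\in H_\Psi$ put $$N_0\varphi(x)=\frac12\sum_{k}\lambda_kD^2\varphi(x)(e_k,e_k)+D\varphi(x)(\Delta(\Psi(x))).$$ Let $\mathcal M$ be the set of Borel probability measures $\nu$ on $H$ such that $\nu$-almost every $x$ lies in $H_\Psi$, $$\int_H\int_D|\nabla(\Psi(x))(\xi)|^2\,d\xi\,\nu(dx)<\infty,$$ and there is $\lambda_\nu\in(0,\infty)$ such that $\int_HN_0\varphi\,d\nu\le\lambda_\nu\int_H\varphi\,d\nu$ for all $\varphi\in C^2_b(H)$ with $\varphi\ge0$ $\nu$-a.e. Proposition 2.4. Let $\nu\in\mathcal M$, and let $\lambda_\nu$ be any constant as above. Then: (i) $N_0\varphi\in L^2(H,\nu)$ for every $\varphi\in C^2_b(H)$. (ii) The operator $N_0-\frac12\lambda_\nu$ with domain $C^2_b(H)$ is dissipative on $L^2(H,\nu)$, that is, $$\|(\lambda+\tfrac12\lambda_\nu-N_0)\varphi\|_{L^2(H,\nu)}\ge\lambda\|\varphi\|_{L^2(H,\nu)}\quad\text{for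 all }\lambda>0\text{ and }\varphi\in C^2_b(H).$$ In particular $N_0$, as an operator on $L^2(H,\nu)$ whose domain is the set of $\nu$-classes of functions in $C^2_b(H)$, is well defined and closable. -/

import Mathlib

open MeasureTheory TopologicalSpace
open scoped ENNReal InnerProductSpace Distributions

noncomputable section

namespace PorousMedia

/-- `ℝ^d` with the Euclidean norm. -/
abbrev Euc (d : ℕ) : Type := EuclideanSpace ℝ (Fin d)

/-- A bounded open subset of `ℝ^d`. -/
structure BoundedOpen (d : ℕ) extends Opens (Euc d) where
  isBounded : Bornology.IsBounded carrier

variable {d : ℕ}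

/-- Lebesgue measure restricted to `D`. -/
abbrev BoundedOpen.vol (D : BoundedOpen d) : Measure (Euc d) := volume.restrict D.carrier

/-- `L²(D)`. -/
abbrev L2 (D : BoundedOpen d) : Type := Lp ℝ 2 D.vol

/-- `L²(D; ℝ^d)`. -/
abbrev L2Vec (D : BoundedOpen d) : Type := Lp (Euc d) 2 D.vol

section TestGraph

variable (D : BoundedOpen d)

lemma testFunction_differentiable {D : BoundedOpen d} (φ : 𝓓(D.toOpens, ℝ)) :
    Differentiable ℝ φ :=
  φ.contDiff.differentiable (by simp)

/-- The set of pairs `(φ, ∇φ)`, `φ ∈ C_c^∞(D)`, as a subspace of `L²(D) × L²(D; ℝ^d)`. -/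
def testGraph : Submodule ℝ (L2 D × L2Vec D) where
  carrier := {p | ∃ φ : 𝓓(D.toOpens, ℝ), p.1 =ᵐ[D.vol] φ ∧ p.2 =ᵐ[D.vol] gradient φ}
  zero_mem' := by
    refine ⟨0, Lp.coeFn_zero _ _ _, (Lp.coeFn_zero _ _ _).trans (.of_forall fun ξ => ?_)⟩
    have h : ((0 : 𝓓(D.toOpens, ℝ)) : Euc d → ℝ) = fun _ => 0 := rfl
    simp [gradient, h]
  add_mem' := by
    rintro p q ⟨φ, h1, h2⟩ ⟨ψ, h3, h4⟩
    refine ⟨φ + ψ, ?_, ?_⟩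
    · filter_upwards [h1, h3, Lp.coeFn_add p.1 q.1] with ξ a b c
      simp only [Prod.fst_add, c, Pi.add_apply, a, b]
      rfl
    · filter_upwards [h2, h4, Lp.coeFn_add p.2 q.2] with ξ a b c
      simp only [Prod.snd_add, c, Pi.add_apply, a, b]
      have h : ((φ + ψ : 𝓓(D.toOpens, ℝ)) : Euc d → ℝ) = fun y => φ y + ψ y := rfl
      simp only [gradient, h]
      rw [fderiv_fun_add (testFunction_differentiable φ ξ) (testFunction_differentiable ψ ξ),
        map_add]
  smul_mem' := by
    rintro c p ⟨φ, h1, h2⟩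
    refine ⟨c • φ, ?_, ?_⟩
    · filter_upwards [h1, Lp.coeFn_smul c p.1] with ξ a b
      simp only [Prod.smul_fst, b, Pi.smul_apply, a]
      rfl
    · filter_upwards [h2, Lp.coeFn_smul c p.2] with ξ a b
      simp only [Prod.smul_snd, b, Pi.smul_apply, a]
      have h : ((c • φ : 𝓓(D.toOpens, ℝ)) : Euc d → ℝ) = fun y => c • φ y := rfl
      simp only [gradient, h]
      rw [fderiv_fun_const_smul (testFunction_differentiable φ ξ)]
      simp

/-- The Sobolev space `H¹₀(D)`, the closure of `C_c^∞(D)` in the graph norm of the gradient.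
An element is stored as the pair `(u, ∇u)` of a function and its weak gradient. -/
def H01 : Type := (testGraph D).topologicalClosure

instance : AddCommGroup (H01 D) := inferInstanceAs (AddCommGroup (testGraph D).topologicalClosure)
instance : Module ℝ (H01 D) := inferInstanceAs (Module ℝ (testGraph D).topologicalClosure)

end TestGraph

variable {D : BoundedOpen d}

/-- The element of `H¹₀(D)` as a function in `L²(D)`. -/
def H01.fn (u : H01 D) : L2 D := u.1.1

/-- The weak gradient of an element of `H¹₀(D)`. -/
def H01.grad (u : H01 D) : L2Vec D := u.1.2

lemma L2_norm_sq {D : BoundedOpen d} {F : Type} [NormedAddCommGroup F] [InnerProductSpace ℝ F]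
    (f : Lp F 2 D.vol) {g : Euc d → F} (h : f =ᵐ[D.vol] g) :
    ‖f‖ ^ 2 = ∫ ξ in D.carrier, ‖g ξ‖ ^ 2 := by
  rw [← real_inner_self_eq_norm_sq, L2.inner_def]
  refine integral_congr_ae ?_
  filter_upwards [h] with ξ hξ
  rw [hξ, real_inner_self_eq_norm_sq]

lemma testFunction_eq_zero {D : BoundedOpen d} (φ : 𝓓(D.toOpens, ℝ)) {ξ : Euc d}
    (h : ξ ∉ D.carrier) : φ ξ = 0 :=
  image_eq_zero_of_notMem_tsupport fun hξ => h (φ.tsupport_subset hξ)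

lemma testFunction_fderiv_eq_zero {D : BoundedOpen d} (φ : 𝓓(D.toOpens, ℝ)) {ξ : Euc d}
    (h : ξ ∉ D.carrier) : fderiv ℝ φ ξ = 0 :=
  image_eq_zero_of_notMem_tsupport
    fun hξ => h (φ.tsupport_subset (tsupport_fderiv_subset ℝ hξ))

/-- Poincaré's inequality for test functions. -/
lemma poincare_test [NeZero d] (D : BoundedOpen d) :
    ∃ K : ℝ, 0 ≤ K ∧ ∀ p ∈ testGraph D, ‖p.1‖ ≤ K * ‖p.2‖ := by
  obtain ⟨R, hR0, hR⟩ := D.isBounded.exists_pos_norm_le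
  refine ⟨2 * R, by positivity, ?_⟩
  rintro p ⟨φ, h1, h2⟩
  have hd := testFunction_differentiable φ
  have hc : Continuous φ := φ.continuous
  have hs : HasCompactSupport φ := φ.hasCompactSupport
  have hcd : Continuous (fderiv ℝ φ) := φ.contDiff.continuous_fderiv (by simp)
  have hsd : HasCompactSupport (fderiv ℝ φ) := hs.fderiv ℝ
  set v : Euc d := EuclideanSpace.single 0 1 with hv
  have hvn : ‖v‖ = 1 := by simp [hv]
  set l : Euc d →L[ℝ] ℝ := EuclideanSpace.proj 0 with hl
  have hlv : l v = 1 := by simp [hl, hv]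
  have hln : ∀ ξ, |l ξ| ≤ ‖ξ‖ := fun ξ => by
    simpa [hl] using PiLp.norm_apply_le ξ 0
  have hcv : Continuous fun ξ => fderiv ℝ φ ξ v := hcd.clm_apply continuous_const
  have hsv : HasCompactSupport fun ξ => fderiv ℝ φ ξ v :=
    hsd.comp_left (g := fun T : Euc d →L[ℝ] ℝ => T v) (by simp)
  have hfd : ∀ ξ, fderiv ℝ (fun y => l y * φ y) ξ v = φ ξ + l ξ * fderiv ℝ φ ξ v := by
    intro ξ
    rw [fderiv_fun_mul l.differentiableAt (hd ξ)]
    simp [hlv]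
    ring
  have i1 : Integrable fun ξ => φ ξ * φ ξ :=
    (hc.mul hc).integrable_of_hasCompactSupport hs.mul_right
  have i2 : Integrable fun ξ => l ξ * fderiv ℝ φ ξ v * φ ξ :=
    ((l.continuous.mul hcv).mul hc).integrable_of_hasCompactSupport hs.mul_left
  have i4 : Integrable fun ξ => ‖fderiv ℝ φ ξ‖ ^ 2 := by
    have hsn : HasCompactSupport fun ξ => ‖fderiv ℝ φ ξ‖ := hsd.norm
    have := (hcd.norm.mul hcd.norm).integrable_of_hasCompactSupport (μ := volume) hsn.mul_right
    exact this.congr (.of_forall fun ξ => by simp only [Pi.mul_apply, sq])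
  have key := integral_mul_fderiv_eq_neg_fderiv_mul_of_integrable (μ := volume)
    (f := fun y => l y * φ y) (g := φ) (v := v) ?_ ?_ ?_
    (fun ξ _ => l.differentiableAt.mul (hd ξ)) (fun ξ _ => hd ξ)
  rotate_left
  · simp only [hfd, add_mul]; exact i1.add i2
  · refine i2.congr (.of_forall fun ξ => ?_); simp only; ring
  · exact ((l.continuous.mul hc).mul hc).integrable_of_hasCompactSupport hs.mul_left
  have e1 : ∫ ξ, l ξ * φ ξ * fderiv ℝ φ ξ v = ∫ ξ, l ξ * fderiv ℝ φ ξ v * φ ξ := by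
    congr 1; ext ξ; ring
  have e2 : ∫ ξ, (φ ξ + l ξ * fderiv ℝ φ ξ v) * φ ξ
      = (∫ ξ, φ ξ * φ ξ) + ∫ ξ, l ξ * fderiv ℝ φ ξ v * φ ξ := by
    simp only [add_mul]; exact integral_add i1 i2
  simp only [hfd, e1, e2] at key
  have hle : ∫ ξ, -(l ξ * fderiv ℝ φ ξ v * φ ξ)
      ≤ ∫ ξ, ((1 / 4) * (φ ξ * φ ξ) + R ^ 2 * ‖fderiv ℝ φ ξ‖ ^ 2) := by
    refine integral_mono i2.neg ((i1.const_mul _).add (i4.const_mul _)) fun ξ => ?_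
    simp only
    by_cases hξ : ξ ∈ D.carrier
    · have a1 : |l ξ| ≤ R := (hln ξ).trans (hR ξ hξ)
      have a2 : |fderiv ℝ φ ξ v| ≤ ‖fderiv ℝ φ ξ‖ := by
        simpa [hvn] using (fderiv ℝ φ ξ).le_opNorm v
      have a3 : |l ξ * fderiv ℝ φ ξ v * φ ξ| ≤ R * ‖fderiv ℝ φ ξ‖ * |φ ξ| := by
        rw [abs_mul, abs_mul]; gcongr
      have a4 := neg_le_of_abs_le a3
      have a5 := sq_abs (φ ξ)
      nlinarith [sq_nonneg (R * ‖fderiv ℝ φ ξ‖ - |φ ξ| / 2)]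
    · simp [testFunction_eq_zero φ hξ]; positivity
  rw [integral_neg, integral_add (i1.const_mul _) (i4.const_mul _), integral_const_mul,
    integral_const_mul] at hle
  have n1 : ‖p.1‖ ^ 2 = ∫ ξ, φ ξ * φ ξ := by
    rw [L2_norm_sq p.1 h1, setIntegral_eq_integral_of_forall_compl_eq_zero]
    · congr 1; ext ξ; rw [Real.norm_eq_abs, sq_abs, sq]
    · intro ξ hξ; simp [testFunction_eq_zero φ hξ]
  have n2 : ‖p.2‖ ^ 2 = ∫ ξ, ‖fderiv ℝ φ ξ‖ ^ 2 := by
    rw [L2_norm_sq p.2 h2]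
    simp only [gradient, LinearIsometryEquiv.norm_map]
    rw [setIntegral_eq_integral_of_forall_compl_eq_zero]
    intro ξ hξ; simp [testFunction_fderiv_eq_zero φ hξ]
  rw [← n1, ← n2] at hle
  rw [← n1] at key
  refine le_of_sq_le_sq ?_ (by positivity)
  nlinarith

lemma poincare [NeZero d] (D : BoundedOpen d) :
    ∃ K : ℝ, 0 ≤ K ∧ ∀ u : H01 D, ‖u.fn‖ ≤ K * ‖u.grad‖ := by
  obtain ⟨K, hK, h⟩ := poincare_test D
  refine ⟨K, hK, fun u => ?_⟩
  have hcl : IsClosed {p : L2 D × L2Vec D | ‖p.1‖ ≤ K * ‖p.2‖} :=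
    isClosed_le (by fun_prop) (by fun_prop)
  exact closure_minimal (s := (testGraph D : Set (L2 D × L2Vec D))) h hcl u.2

/-- The inner product `∫_D ∇u · ∇v` on `H¹₀(D)`. -/
abbrev H01.core [NeZero d] (D : BoundedOpen d) : InnerProductSpace.Core ℝ (H01 D) where
  inner u v := ⟪u.grad, v.grad⟫_ℝ
  conj_inner_symm u v := inner_conj_symm u.grad v.grad
  re_inner_nonneg u := real_inner_self_nonneg (x := u.grad)
  add_left u v w := inner_add_left u.grad v.grad w.grad
  smul_left u v c := inner_smul_left u.grad v.grad c
  definite u hu := by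
    have hg : u.grad = 0 := inner_self_eq_zero.1 hu
    obtain ⟨K, -, h⟩ := poincare D
    have hf : u.fn = 0 := by simpa [hg] using h u
    exact Subtype.ext (Prod.ext hf hg)

instance [NeZero d] (D : BoundedOpen d) : NormedAddCommGroup (H01 D) :=
  (H01.core D).toNormedAddCommGroup

instance [NeZero d] (D : BoundedOpen d) : InnerProductSpace ℝ (H01 D) :=
  InnerProductSpace.ofCore (H01.core D).toCore

lemma H01.norm_eq [NeZero d] (u : H01 D) : ‖u‖ = ‖u.grad‖ := by
  rw [← sq_eq_sq₀ (norm_nonneg _) (norm_nonneg _), ← real_inner_self_eq_norm_sq,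
    ← real_inner_self_eq_norm_sq]
  rfl

instance [NeZero d] (D : BoundedOpen d) : CompleteSpace (H01 D) := by
  refine Metric.complete_of_cauchySeq_tendsto fun s hs => ?_
  obtain ⟨K, hK, h⟩ := poincare D
  have hg : CauchySeq fun n => (s n).grad := by
    rw [Metric.cauchySeq_iff'] at hs ⊢
    intro ε hε
    obtain ⟨N, hN⟩ := hs ε hε
    refine ⟨N, fun n hn => ?_⟩
    have := hN n hn
    rw [dist_eq_norm] at this ⊢
    rwa [H01.norm_eq] at this
  have hf : CauchySeq fun n => (s n).fn := by
    rw [Metric.cauchySeq_iff'] at hs ⊢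
    intro ε hε
    obtain ⟨N, hN⟩ := hs (ε / (K + 1)) (by positivity)
    refine ⟨N, fun n hn => ?_⟩
    have h1 := hN n hn
    rw [dist_eq_norm, H01.norm_eq, lt_div_iff₀ (by positivity)] at h1
    have h2 := h (s n - s N)
    rw [dist_eq_norm]
    refine lt_of_le_of_lt h2 (lt_of_le_of_lt ?_ h1)
    nlinarith [norm_nonneg (s n - s N).grad]
  obtain ⟨f, hf⟩ := cauchySeq_tendsto_of_complete hf
  obtain ⟨g, hg⟩ := cauchySeq_tendsto_of_complete hg
  have hm : (f, g) ∈ (testGraph D).topologicalClosure :=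
    (testGraph D).isClosed_topologicalClosure.mem_of_tendsto (hf.prodMk_nhds hg)
      (.of_forall fun n => (s n).2)
  refine ⟨⟨(f, g), hm⟩, ?_⟩
  let w : H01 D := ⟨(f, g), hm⟩
  change Filter.Tendsto s Filter.atTop (nhds w)
  rw [tendsto_iff_norm_sub_tendsto_zero] at hg ⊢
  refine hg.congr fun n => ?_
  rw [H01.norm_eq]
  rfl

/-- The inclusion `H¹₀(D) → L²(D)`, bounded by Poincaré's inequality. -/
def H01.fnCLM [NeZero d] (D : BoundedOpen d) : H01 D →L[ℝ] L2 D :=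
  LinearMap.mkContinuousOfExistsBound
    { toFun := H01.fn
      map_add' := fun _ _ => rfl
      map_smul' := fun _ _ => rfl }
    (by
      obtain ⟨K, -, h⟩ := poincare D
      exact ⟨K, fun u => (h u).trans_eq (by rw [H01.norm_eq])⟩)

/-- `H = H⁻¹(D)`, the dual of `H¹₀(D)`, with the dual norm and its Borel `σ`-algebra. -/
abbrev Hm1 [NeZero d] (D : BoundedOpen d) : Type := StrongDual ℝ (H01 D)

/-- The inner product of `H⁻¹(D)`, polarizing the dual norm. As the Riesz isomorphism of `H¹₀(D)` is
`-Δ`, this is `⟨x, y⟩ = ∫_D ∇(-Δ)⁻¹x · ∇(-Δ)⁻¹y = ((-Δ)⁻¹x)(y)`. -/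
instance [NeZero d] (D : BoundedOpen d) : InnerProductSpace ℝ (Hm1 D) where
  inner x y := ⟪(InnerProductSpace.toDual ℝ (H01 D)).symm x,
    (InnerProductSpace.toDual ℝ (H01 D)).symm y⟫_ℝ
  norm_sq_eq_re_inner x := by
    rw [real_inner_self_eq_norm_sq, LinearIsometryEquiv.norm_map]; rfl
  conj_inner_symm x y := inner_conj_symm _ _
  add_left x y z := by rw [map_add, inner_add_left]
  smul_left x y c := by
    rw [LinearIsometryEquiv.map_smulₛₗ, inner_smul_left]; rfl

/-- The embedding `L²(D) ⊂ H⁻¹(D)`: `f` acts on `H¹₀(D)` by `v ↦ ∫_D f v`. -/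
def ofL2 [NeZero d] (f : L2 D) : Hm1 D := (innerSL ℝ f).comp (H01.fnCLM D)

/-- The Dirichlet Laplacian `Δ : H¹₀(D) → H⁻¹(D)`, `(Δu)(v) = -∫_D ∇u · ∇v`. -/
def lap [NeZero d] (u : H01 D) : Hm1 D := -(InnerProductSpace.toDual ℝ (H01 D) u)

lemma lap_apply [NeZero d] (u v : H01 D) :
    lap u v = -∫ ξ in D.carrier, ⟪u.grad ξ, v.grad ξ⟫_ℝ := by
  have h : lap u v = -⟪u.grad, v.grad⟫_ℝ := rfl
  rw [h, L2.inner_def]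

lemma ofL2_apply [NeZero d] (f : L2 D) (v : H01 D) :
    ofL2 f v = ∫ ξ in D.carrier, f ξ * v.fn ξ := by
  have h : ofL2 f v = ⟪f, v.fn⟫_ℝ := rfl
  rw [h, L2.inner_def]
  simp only [RCLike.inner_apply, mul_comm]
  rfl

/-- `(e_k)` is an orthonormal basis of `H⁻¹(D)` consisting of eigenfunctions `e_k ∈ H¹₀(D)` of the
Dirichlet Laplacian. -/
structure IsEigenbasis [NeZero d] (e : ℕ → H01 D) : Prop where
  orthonormal : Orthonormal ℝ fun k => (ofL2 (e k).fn : Hm1 D)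
  total : (Submodule.span ℝ (Set.range fun k => (ofL2 (e k).fn : Hm1 D))).topologicalClosure = ⊤
  eigen : ∀ k, ∃ μ : ℝ, lap (e k) = μ • ofL2 (e k).fn

/-- `sup_D |u|²` (the essential supremum, as `u` is a class of functions). -/
def supSq (u : H01 D) : ℝ≥0∞ := eLpNorm u.fn ∞ D.vol ^ 2

/-- Growth condition on the nonlinearity `Ψ`. -/
def IsPorousNonlinearity (Ψ : ℝ → ℝ) : Prop :=
  ContDiff ℝ 1 Ψ ∧ ∃ r κ₀ κ₁ C₁ : ℝ, 1 < r ∧ 0 < κ₀ ∧ 0 < κ₁ ∧ 0 < C₁ ∧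
    ∀ s : ℝ, κ₀ * |s| ^ (r - 1) ≤ deriv Ψ s ∧ deriv Ψ s ≤ κ₁ * |s| ^ (r - 1) + C₁

/-- `x ∈ H⁻¹(D)` is given by a function `f ∈ L²(D)` with `Ψ(f) = u ∈ H¹₀(D)`. -/
def IsPsi [NeZero d] (Ψ : ℝ → ℝ) (x : Hm1 D) (u : H01 D) : Prop :=
  ∃ f : L2 D, ofL2 f = x ∧ u.fn =ᵐ[D.vol] fun ξ => Ψ (f ξ)

/-- `H_Ψ = {x ∈ L²(D) : Ψ(x) ∈ H¹₀(D)}` as a subset of `H⁻¹(D)`. -/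
def HPsi [NeZero d] (D : BoundedOpen d) (Ψ : ℝ → ℝ) : Set (Hm1 D) := {x | ∃ u, IsPsi Ψ x u}

lemma continuous_gradient_test (φ : 𝓓(D.toOpens, ℝ)) : Continuous (gradient φ) :=
  (InnerProductSpace.toDual ℝ (Euc d)).symm.continuous.comp
    (φ.contDiff.continuous_fderiv (by simp))

lemma hasCompactSupport_gradient_test (φ : 𝓓(D.toOpens, ℝ)) : HasCompactSupport (gradient φ) :=
  (φ.hasCompactSupport.fderiv ℝ).comp_left
    (g := fun T : Euc d →L[ℝ] ℝ => (InnerProductSpace.toDual ℝ (Euc d)).symm T) (by simp)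

/-- Test functions as elements of `H¹₀(D)`. -/
lemma exists_fn_eq_test (φ : 𝓓(D.toOpens, ℝ)) : ∃ v : H01 D, v.fn =ᵐ[D.vol] φ := by
  have h1 : MemLp φ 2 D.vol :=
    φ.continuous.memLp_of_hasCompactSupport φ.hasCompactSupport
  have h2 : MemLp (gradient φ) 2 D.vol :=
    (continuous_gradient_test φ).memLp_of_hasCompactSupport (hasCompactSupport_gradient_test φ)
  exact ⟨⟨(h1.toLp, h2.toLp), subset_closure ⟨φ, h1.coeFn_toLp, h2.coeFn_toLp⟩⟩, h1.coeFn_toLp⟩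

lemma ae_eq_zero_of_test {f : Euc d → ℝ} (hf : MemLp f 2 D.vol)
    (h : ∀ φ : 𝓓(D.toOpens, ℝ), ∫ ξ in D.carrier, φ ξ * f ξ = 0) : f =ᵐ[D.vol] 0 := by
  have hloc : LocallyIntegrableOn f D.carrier volume :=
    locallyIntegrableOn_of_locallyIntegrable_restrict (hf.locallyIntegrable (by norm_num))
  have := D.is_open'.ae_eq_zero_of_integral_contDiff_smul_eq_zero (μ := volume) (f := f) hloc ?_
  · exact (ae_restrict_iff' D.is_open'.measurableSet).2 this
  · intro g hg hgs hgD
    rw [← h ⟨g, hg, hgs, hgD⟩, setIntegral_eq_integral_of_forall_compl_eq_zero]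
    · rfl
    · intro ξ hξ
      rw [testFunction_eq_zero _ hξ, zero_mul]

lemma ofL2_injective [NeZero d] : Function.Injective (ofL2 : L2 D → Hm1 D) := by
  intro f g hfg
  have h0 : f - g = 0 := by
    refine (Lp.eq_zero_iff_ae_eq_zero).2 (ae_eq_zero_of_test (Lp.memLp _) fun φ => ?_)
    obtain ⟨v, hv⟩ := exists_fn_eq_test φ
    have h1 : ⟪f - g, v.fn⟫_ℝ = 0 := by
      rw [inner_sub_left, sub_eq_zero]
      exact DFunLike.congr_fun hfg v
    rw [L2.inner_def] at h1
    rw [← h1]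
    refine integral_congr_ae ?_
    filter_upwards [hv] with ξ hξ
    rw [hξ]
    rfl
  exact sub_eq_zero.1 h0

lemma test_ibp (φ ψ : 𝓓(D.toOpens, ℝ)) (w : Euc d) :
    ∫ ξ in D.carrier, φ ξ * fderiv ℝ ψ ξ w = - ∫ ξ in D.carrier, fderiv ℝ φ ξ w * ψ ξ := by
  have hcd : ∀ χ : 𝓓(D.toOpens, ℝ), Continuous fun ξ => fderiv ℝ χ ξ w := fun χ =>
    (χ.contDiff.continuous_fderiv (by simp)).clm_apply continuous_const
  rw [setIntegral_eq_integral_of_forall_compl_eq_zero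
      (fun ξ hξ => by rw [testFunction_eq_zero _ hξ, zero_mul]),
    setIntegral_eq_integral_of_forall_compl_eq_zero
      (fun ξ hξ => by rw [testFunction_eq_zero _ hξ, mul_zero])]
  refine integral_mul_fderiv_eq_neg_fderiv_mul_of_integrable ?_ ?_ ?_
    (fun ξ _ => testFunction_differentiable φ ξ) (fun ξ _ => testFunction_differentiable ψ ξ)
  · exact ((hcd φ).mul ψ.continuous).integrable_of_hasCompactSupport ψ.hasCompactSupport.mul_left
  · exact (φ.continuous.mul (hcd ψ)).integrable_of_hasCompactSupport φ.hasCompactSupport.mul_right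
  · exact (φ.continuous.mul ψ.continuous).integrable_of_hasCompactSupport
      φ.hasCompactSupport.mul_right

lemma weak_gradient (u : H01 D) (ψ : 𝓓(D.toOpens, ℝ)) (w : Euc d) :
    ∫ ξ in D.carrier, ψ ξ * ⟪w, u.grad ξ⟫_ℝ = - ∫ ξ in D.carrier, fderiv ℝ ψ ξ w * u.fn ξ := by
  have hcw : Continuous fun ξ => fderiv ℝ ψ ξ w :=
    (ψ.contDiff.continuous_fderiv (by simp)).clm_apply continuous_const
  have hsw : HasCompactSupport fun ξ => fderiv ℝ ψ ξ w :=
    (ψ.hasCompactSupport.fderiv ℝ).comp_left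
      (g := fun T : Euc d →L[ℝ] ℝ => T w) (by simp)
  have h1 : MemLp (fun ξ => ψ ξ • w) 2 D.vol :=
    (ψ.continuous.smul continuous_const).memLp_of_hasCompactSupport ψ.hasCompactSupport.smul_right
  have h2 : MemLp (fun ξ => fderiv ℝ ψ ξ w) 2 D.vol := hcw.memLp_of_hasCompactSupport hsw
  have i1 : ∀ g : L2Vec D, ⟪h1.toLp, g⟫_ℝ = ∫ ξ in D.carrier, ψ ξ * ⟪w, g ξ⟫_ℝ := fun g => by
    rw [L2.inner_def]
    refine integral_congr_ae ?_
    filter_upwards [h1.coeFn_toLp] with ξ hξ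
    rw [hξ, real_inner_smul_left]
  have i2 : ∀ f : L2 D, ⟪h2.toLp, f⟫_ℝ = ∫ ξ in D.carrier, fderiv ℝ ψ ξ w * f ξ := fun f => by
    rw [L2.inner_def]
    refine integral_congr_ae ?_
    filter_upwards [h2.coeFn_toLp] with ξ hξ
    rw [hξ]
    exact mul_comm _ _
  have hcl : IsClosed {p : L2 D × L2Vec D | ⟪h1.toLp, p.2⟫_ℝ = -⟪h2.toLp, p.1⟫_ℝ} :=
    isClosed_eq (by fun_prop) (by fun_prop)
  have hsub : (testGraph D : Set (L2 D × L2Vec D)) ⊆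
      {p : L2 D × L2Vec D | ⟪h1.toLp, p.2⟫_ℝ = -⟪h2.toLp, p.1⟫_ℝ} := by
    rintro p ⟨φ, hp1, hp2⟩
    have a1 : ∫ ξ in D.carrier, ψ ξ * ⟪w, p.2 ξ⟫_ℝ
        = ∫ ξ in D.carrier, ψ ξ * fderiv ℝ φ ξ w := by
      refine integral_congr_ae ?_
      filter_upwards [hp2] with ξ hξ
      rw [hξ, real_inner_comm, gradient, InnerProductSpace.toDual_symm_apply]
    have a2 : ∫ ξ in D.carrier, fderiv ℝ ψ ξ w * p.1 ξ
        = ∫ ξ in D.carrier, fderiv ℝ ψ ξ w * φ ξ := by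
      refine integral_congr_ae ?_
      filter_upwards [hp1] with ξ hξ
      rw [hξ]
    simp only [Set.mem_ofPred_eq, i1, i2, a1, a2]
    exact test_ibp ψ φ w
  have := closure_minimal hsub hcl u.2
  simp only [Set.mem_ofPred_eq, i1, i2] at this
  exact this

/-- An element of `H¹₀(D)` is determined by its function. -/
lemma fn_injective : Function.Injective (H01.fn : H01 D → L2 D) := by
  intro u v huv
  have hg : (u - v).grad = 0 := by
    refine (Lp.eq_zero_iff_ae_eq_zero).2 ?_
    have hz : (u - v).fn = 0 := sub_eq_zero.2 huv
    have hw : ∀ i : Fin d, (fun ξ => ⟪EuclideanSpace.single i (1 : ℝ), (u - v).grad ξ⟫_ℝ)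
        =ᵐ[D.vol] 0 := fun i => by
      refine ae_eq_zero_of_test ((Lp.memLp (u - v).grad).const_inner _) fun ψ => ?_
      rw [weak_gradient, hz, neg_eq_zero]
      refine integral_eq_zero_of_ae ?_
      filter_upwards [Lp.coeFn_zero ℝ 2 D.vol] with ξ hξ
      rw [hξ]
      simp
    filter_upwards [ae_all_iff.2 hw] with ξ hξ
    have h0 : (u - v).grad ξ = 0 := by
      ext i
      have h := hξ i
      rw [EuclideanSpace.inner_single_left] at h
      simpa using h
    exact h0
  exact Subtype.ext (Prod.ext huv (sub_eq_zero.1 hg))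

/-- `Ψ(x)` is unique. -/
lemma IsPsi.unique [NeZero d] {Ψ : ℝ → ℝ} {x : Hm1 D} {u v : H01 D}
    (hu : IsPsi Ψ x u) (hv : IsPsi Ψ x v) : u = v := by
  obtain ⟨f, hf, hu⟩ := hu
  obtain ⟨g, hg, hv⟩ := hv
  obtain rfl : f = g := ofL2_injective (hf.trans hg.symm)
  exact fn_injective (Lp.ext (hu.trans hv.symm))

open Classical in
/-- `Ψ(x) ∈ H¹₀(D)` for `x ∈ H_Ψ`, and `0` for `x ∉ H_Ψ`. -/
def psi [NeZero d] (Ψ : ℝ → ℝ) (x : Hm1 D) : H01 D :=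
  if h : ∃ u, IsPsi Ψ x u then h.choose else 0

lemma psi_eq [NeZero d] {Ψ : ℝ → ℝ} {x : Hm1 D} {u : H01 D} (h : IsPsi Ψ x u) : psi Ψ x = u := by
  have hx : ∃ u, IsPsi Ψ x u := ⟨u, h⟩
  rw [psi, dif_pos hx]
  exact hx.choose_spec.unique h

/-- `φ ∈ C²_b(H)`: twice continuously Fréchet differentiable, and bounded together with the first
and second derivative. -/
structure IsCb2 {H : Type*} [NormedAddCommGroup H] [NormedSpace ℝ H] (φ : H → ℝ) : Prop where
  contDiff : ContDiff ℝ 2 φ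
  bounded : ∃ M : ℝ, ∀ x, |φ x| ≤ M ∧ ‖fderiv ℝ φ x‖ ≤ M ∧ ‖fderiv ℝ (fderiv ℝ φ) x‖ ≤ M

/-- The Kolmogorov operator
`N₀φ(x) = ½ ∑ₖ λₖ D²φ(x)(eₖ, eₖ) + Dφ(x)(ΔΨ(x))` (meaningful for `x ∈ H_Ψ`). -/
def N0 [NeZero d] (Ψ : ℝ → ℝ) (e : ℕ → H01 D) (lam : ℕ → ℝ) (φ : Hm1 D → ℝ) (x : Hm1 D) : ℝ :=
  1 / 2 * ∑' k, lam k * fderiv ℝ (fderiv ℝ φ) x (ofL2 (e k).fn) (ofL2 (e k).fn)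
    + fderiv ℝ φ x (lap (psi Ψ x))

/-- `ν ∈ 𝓜` with constant `c = λ_ν`: `ν` is an infinitesimally excessive probability measure. -/
structure IsExcessive [NeZero d] (Ψ : ℝ → ℝ) (e : ℕ → H01 D) (lam : ℕ → ℝ)
    (ν : Measure (Hm1 D)) (c : ℝ) : Prop where
  isProbabilityMeasure : IsProbabilityMeasure ν
  ae_mem : ∀ᵐ x ∂ν, x ∈ HPsi D Ψ
  energy : ∫⁻ x, (∫⁻ ξ in D.carrier, ‖(psi Ψ x).grad ξ‖ₑ ^ 2) ∂ν < ∞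
  pos : 0 < c
  excessive : ∀ φ : Hm1 D → ℝ, IsCb2 φ → (∀ᵐ x ∂ν, 0 ≤ φ x) →
    ∫ x, N0 Ψ e lam φ x ∂ν ≤ c * ∫ x, φ x ∂ν

end PorousMedia

end

/-!
The quadratic form of `N₀` on `L²(H, ν)` is bounded above: since `∑ₖ λₖ (Dφ(eₖ))² ≥ 0`, one has
`N₀(φ²) ≥ 2φ N₀φ`, and integrating against the infinitesimally excessive measure `ν` gives
`∫ φ N₀φ dν ≤ (c / 2) ∫ φ² dν` (`integral_mul_kolmogorov_le`). Dissipativity is then the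
Cauchy–Schwarz inequality (`mul_norm_le_of_inner_le`).

For closability, the form bound `⟪f, g⟫ ≤ (c / 2) ‖f‖²` extends to all `(f, g)` in the closure of
the graph. If `(0, g₀)` lies in the closure, replacing `g` by `g + s g₀` for arbitrary real `s`
shows `g₀ ⊥ C²_b` (`eq_zero_of_mem_closure_of_inner_le`). The functions `cos ∘ L` and `sin ∘ L`,
`L ∈ H*`, are in `C²_b`, so the characteristic functional of `g₀ ν` vanishes and `g₀ = 0`
(`ae_eq_zero_of_integral_mul_Cb2`). The same argument with `(0, g₀)` in the graph itself shows that
`N₀` respects `ν`-classes.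

All of this works for a Kolmogorov operator with square integrable drift on a separable Banach
space. What is particular to the porous medium equation is that the drift `x ↦ ΔΨ(x)` is in
`L²(ν; H)`. The norm bound is the energy condition; measurability holds because the graph of
`f ↦ Ψ(f)` is closed in `L²(D) × H¹₀(D)` and injects continuously into `H⁻¹(D)`, so that the
Lusin–Souslin theorem applies (`exists_measurable_eq_psi`).
-/

namespace PorousMedia

/-! ### The class `C²_b` -/

section Cb2

variable {H : Type*} [NormedAddCommGroup H] [NormedSpace ℝ H] {φ ψ : H → ℝ}

namespace IsCb2

lemma differentiable (h : IsCb2 φ) : Differentiable ℝ φ :=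
  h.contDiff.differentiable (by norm_num)

lemma contDiff_fderiv (h : IsCb2 φ) : ContDiff ℝ 1 (fderiv ℝ φ) :=
  h.contDiff.fderiv_right (by norm_num)

lemma differentiable_fderiv (h : IsCb2 φ) : Differentiable ℝ (fderiv ℝ φ) :=
  h.contDiff_fderiv.differentiable (by norm_num)

lemma continuous_fderiv_fderiv (h : IsCb2 φ) : Continuous (fderiv ℝ (fderiv ℝ φ)) :=
  h.contDiff_fderiv.continuous_fderiv (by norm_num)

lemma fderiv_add (h : IsCb2 φ) (k : IsCb2 ψ) :
    fderiv ℝ (φ + ψ) = fderiv ℝ φ + fderiv ℝ ψ :=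
  funext fun x => _root_.fderiv_add (h.differentiable x) (k.differentiable x)

lemma fderiv_fderiv_add (h : IsCb2 φ) (k : IsCb2 ψ) :
    fderiv ℝ (fderiv ℝ (φ + ψ)) = fderiv ℝ (fderiv ℝ φ) + fderiv ℝ (fderiv ℝ ψ) := by
  rw [h.fderiv_add k]
  exact funext fun x =>
    _root_.fderiv_add (h.differentiable_fderiv x) (k.differentiable_fderiv x)

lemma fderiv_smul (h : IsCb2 φ) (a : ℝ) : fderiv ℝ (a • φ) = a • fderiv ℝ φ :=
  funext fun x => fderiv_const_smul (h.differentiable x) a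

lemma fderiv_fderiv_smul (h : IsCb2 φ) (a : ℝ) :
    fderiv ℝ (fderiv ℝ (a • φ)) = a • fderiv ℝ (fderiv ℝ φ) := by
  rw [h.fderiv_smul a]
  exact funext fun x => fderiv_const_smul (h.differentiable_fderiv x) a

lemma fderiv_sq (h : IsCb2 φ) : fderiv ℝ (φ ^ 2) = fun x => (2 * φ x) • fderiv ℝ φ x := by
  funext x
  change fderiv ℝ (fun y => φ y ^ 2) x = _
  simpa using ((h.differentiable x).hasFDerivAt.pow 2).fderiv

lemma fderiv_fderiv_sq (h : IsCb2 φ) (x : H) :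
    fderiv ℝ (fderiv ℝ (φ ^ 2)) x = (2 * φ x) • fderiv ℝ (fderiv ℝ φ) x
      + ((2 : ℝ) • fderiv ℝ φ x).smulRight (fderiv ℝ φ x) := by
  rw [h.fderiv_sq]
  exact (((h.differentiable x).hasFDerivAt.const_mul 2).smul
    (h.differentiable_fderiv x).hasFDerivAt).fderiv

lemma add (h : IsCb2 φ) (k : IsCb2 ψ) : IsCb2 (φ + ψ) where
  contDiff := h.contDiff.add k.contDiff
  bounded := by
    obtain ⟨M, hM⟩ := h.bounded
    obtain ⟨N, hN⟩ := k.bounded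
    refine ⟨M + N, fun x => ?_⟩
    rw [h.fderiv_fderiv_add k, h.fderiv_add k]
    obtain ⟨a, b, c⟩ := hM x
    obtain ⟨a', b', c'⟩ := hN x
    simp only [Pi.add_apply]
    exact ⟨(abs_add_le _ _).trans (add_le_add a a'), norm_add_le_of_le b b',
      (ContinuousLinearMap.opNorm_add_le _ _).trans (add_le_add c c')⟩

lemma smul (h : IsCb2 φ) (a : ℝ) : IsCb2 (a • φ) where
  contDiff := contDiff_const.smul h.contDiff
  bounded := by
    obtain ⟨M, hM⟩ := h.bounded
    refine ⟨|a| * M, fun x => ?_⟩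
    rw [h.fderiv_fderiv_smul a, h.fderiv_smul a]
    simp only [Pi.smul_apply, smul_eq_mul, abs_mul, norm_smul, Real.norm_eq_abs]
    obtain ⟨p, q, r⟩ := hM x
    exact ⟨mul_le_mul_of_nonneg_left p (abs_nonneg a), mul_le_mul_of_nonneg_left q (abs_nonneg a),
      (ContinuousLinearMap.opNorm_smul_le _ _).trans (mul_le_mul_of_nonneg_left r (abs_nonneg a))⟩

lemma zero : IsCb2 (0 : H → ℝ) where
  contDiff := contDiff_const
  bounded := ⟨0, fun x => by
    simp only [fderiv_zero]
    exact ⟨by simp, by simp, ContinuousLinearMap.opNorm_zero.le⟩⟩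

lemma sq (h : IsCb2 φ) : IsCb2 (φ ^ 2) where
  contDiff := h.contDiff.pow 2
  bounded := by
    obtain ⟨M, hM⟩ := h.bounded
    refine ⟨4 * M ^ 2, fun x => ?_⟩
    obtain ⟨a, b, c⟩ := hM x
    have hM0 : 0 ≤ M := (abs_nonneg _).trans a
    have a2 : ‖(2 * φ x : ℝ)‖ ≤ 2 * M := by
      rw [Real.norm_eq_abs, abs_mul, abs_two]; gcongr
    rw [h.fderiv_fderiv_sq, h.fderiv_sq]
    simp only [Pi.pow_apply]
    refine ⟨?_, ?_, ?_⟩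
    · have := pow_le_pow_left₀ (abs_nonneg _) a 2
      rw [abs_pow]
      nlinarith [sq_nonneg M]
    · rw [norm_smul]
      have := mul_le_mul a2 b (norm_nonneg _) (by positivity)
      nlinarith [sq_nonneg M]
    · refine (ContinuousLinearMap.opNorm_add_le _ _).trans ?_
      have h1 := (ContinuousLinearMap.opNorm_smul_le (2 * φ x) (fderiv ℝ (fderiv ℝ φ) x)).trans
        (mul_le_mul a2 c (ContinuousLinearMap.opNorm_nonneg _) (by positivity))
      rw [ContinuousLinearMap.norm_smulRight_apply]
      have h3 : ‖(2 : ℝ) • fderiv ℝ φ x‖ ≤ 2 * M := by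
        rw [norm_smul, Real.norm_two]; linarith
      have h2 := mul_le_mul h3 b (norm_nonneg _) (by positivity)
      nlinarith

/-- Ridge functions: a `C²` function on the line, bounded with its derivatives, composed with a
continuous functional. -/
lemma comp_dual {g g' g'' : ℝ → ℝ} (hg : ∀ t, HasDerivAt g (g' t) t)
    (hg' : ∀ t, HasDerivAt g' (g'' t) t) (hgc : ContDiff ℝ 2 g) (b : ∀ t, |g t| ≤ 1)
    (b' : ∀ t, |g' t| ≤ 1) (b'' : ∀ t, |g'' t| ≤ 1) (L : StrongDual ℝ H) :
    IsCb2 fun x => g (L x) where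
  contDiff := hgc.comp L.contDiff
  bounded := by
    have d1 : fderiv ℝ (fun x => g (L x)) = fun x => g' (L x) • L :=
      funext fun x => ((hg (L x)).comp_hasFDerivAt x L.hasFDerivAt).fderiv
    have d2 : ∀ x, fderiv ℝ (fun x => g' (L x) • L) x = (g'' (L x) • L).smulRight L := fun x =>
      (((hg' (L x)).comp_hasFDerivAt x L.hasFDerivAt).smul_const L).fderiv
    refine ⟨1 + ‖L‖ + ‖L‖ * ‖L‖, fun x => ?_⟩
    rw [d1, d2, ContinuousLinearMap.norm_smulRight_apply, norm_smul, norm_smul, Real.norm_eq_abs,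
      Real.norm_eq_abs]
    have h1 := mul_le_mul_of_nonneg_right (b' (L x)) (norm_nonneg L)
    have h2 := mul_le_mul_of_nonneg_right (b'' (L x)) (mul_nonneg (norm_nonneg L) (norm_nonneg L))
    have h3 := norm_nonneg L
    have h4 := mul_nonneg h3 h3
    refine ⟨(b _).trans ?_, ?_, ?_⟩ <;> linarith

lemma cos (L : StrongDual ℝ H) : IsCb2 fun x => Real.cos (L x) :=
  comp_dual (fun t => Real.hasDerivAt_cos t) (fun t => (Real.hasDerivAt_sin t).neg)
    Real.contDiff_cos Real.abs_cos_le_one (fun t => by simpa using Real.abs_sin_le_one t)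
    (fun t => by simpa using Real.abs_cos_le_one t) L

lemma sin (L : StrongDual ℝ H) : IsCb2 fun x => Real.sin (L x) :=
  comp_dual (fun t => Real.hasDerivAt_sin t) (fun t => Real.hasDerivAt_cos t)
    Real.contDiff_sin Real.abs_sin_le_one Real.abs_cos_le_one
    (fun t => by simpa using Real.abs_sin_le_one t) L

lemma memLp [MeasurableSpace H] [BorelSpace H] (h : IsCb2 φ) (ν : Measure H) [IsFiniteMeasure ν] :
    MemLp φ 2 ν := by
  obtain ⟨M, hM⟩ := h.bounded
  exact MemLp.of_bound h.contDiff.continuous.measurable.aestronglyMeasurable M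
    (.of_forall fun x => (hM x).1)

end IsCb2

/-- An integrable function orthogonal to all of `C²_b` vanishes: testing against `cos ∘ L` and
`sin ∘ L` shows that the measures with densities `g⁺` and `g⁻` have the same characteristic
functional. -/
lemma ae_eq_zero_of_integral_mul_Cb2 [CompleteSpace H] [SecondCountableTopology H]
    [MeasurableSpace H] [BorelSpace H] {ν : Measure H} {g : H → ℝ} (hg : Integrable g ν)
    (h : ∀ φ : H → ℝ, IsCb2 φ → ∫ x, φ x * g x ∂ν = 0) : g =ᵐ[ν] 0 := by
  wlog hm : Measurable g generalizing g
  · have hmk : g =ᵐ[ν] hg.1.mk g := hg.1.ae_eq_mk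
    refine hmk.trans (this (hg.congr hmk) (fun φ hφ => ?_) hg.1.stronglyMeasurable_mk.measurable)
    rw [← h φ hφ]
    refine integral_congr_ae ?_
    filter_upwards [hmk] with x hx
    rw [hx]
  have hp := hg.lintegral_lt_top
  have hn := hg.neg.lintegral_lt_top
  have : IsFiniteMeasure (ν.withDensity fun x => ENNReal.ofReal (g x)) :=
    isFiniteMeasure_withDensity hp.ne
  have : IsFiniteMeasure (ν.withDensity fun x => ENNReal.ofReal ((-g) x)) :=
    isFiniteMeasure_withDensity hn.ne
  have key : ν.withDensity (fun x => ENNReal.ofReal (g x))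
      = ν.withDensity fun x => ENNReal.ofReal ((-g) x) := by
    refine Measure.ext_of_charFunDual (funext fun L => ?_)
    have hexp : AEStronglyMeasurable (fun x => Complex.exp (L x * Complex.I)) ν :=
      (by fun_prop : Continuous fun x =>
        Complex.exp (L x * Complex.I)).measurable.aestronglyMeasurable
    have hb : ∀ᵐ x ∂ν, ‖Complex.exp (L x * Complex.I)‖ ≤ 1 :=
      .of_forall fun x => (Complex.norm_exp_ofReal_mul_I _).le
    have ip : Integrable
        (fun x => (ENNReal.ofReal (g x)).toReal • Complex.exp (L x * Complex.I)) ν :=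
      hg.real_toNNReal.smul_bdd 1 hexp hb
    have im : Integrable
        (fun x => (ENNReal.ofReal ((-g) x)).toReal • Complex.exp (L x * Complex.I)) ν :=
      hg.neg.real_toNNReal.smul_bdd 1 hexp hb
    have hcos := h _ (IsCb2.cos L)
    have hsin := h _ (IsCb2.sin L)
    have icos : Integrable (fun x => Real.cos (L x) * g x) ν :=
      hg.bdd_mul (c := 1) (by fun_prop) (.of_forall fun x => Real.abs_cos_le_one _)
    have isin : Integrable (fun x => Real.sin (L x) * g x) ν :=
      hg.bdd_mul (c := 1) (by fun_prop) (.of_forall fun x => Real.abs_sin_le_one _)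
    rw [charFunDual_apply, charFunDual_apply,
      integral_withDensity_eq_integral_toReal_smul (by fun_prop) (by simp),
      integral_withDensity_eq_integral_toReal_smul (by fun_prop) (by simp), ← sub_eq_zero,
      ← integral_sub ip im]
    calc _ = ∫ x, (((Real.cos (L x) * g x : ℝ) : ℂ)
            + ((Real.sin (L x) * g x : ℝ) : ℂ) * Complex.I) ∂ν := by
          refine integral_congr_ae (.of_forall fun x => ?_)
          have h1 : max (g x) 0 - max (-g x) 0 = g x := by
            rcases le_total (g x) 0 with h4 | h4
            · rw [max_eq_right h4, max_eq_left (by linarith)]; ring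
            · rw [max_eq_left h4, max_eq_right (by linarith)]; ring
          have h2 : ((max (g x) 0 : ℝ) : ℂ) - ((max (-g x) 0 : ℝ) : ℂ) = g x := by
            rw [← Complex.ofReal_sub, h1]
          simp only [Pi.neg_apply, ENNReal.toReal_ofReal', Complex.real_smul, Complex.exp_mul_I,
            Complex.ofReal_mul, Complex.ofReal_cos, Complex.ofReal_sin]
          linear_combination (Complex.cos (L x) + Complex.sin (L x) * Complex.I) * h2
      _ = 0 := by
          rw [integral_add icos.ofReal (isin.ofReal.mul_const _), integral_mul_const,
            integral_complex_ofReal, integral_complex_ofReal, hcos, hsin]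
          simp
  have h2 := (withDensity_eq_iff (by fun_prop) (by fun_prop) hp.ne).1 key
  filter_upwards [h2] with x hx
  have h3 := congrArg ENNReal.toReal hx
  rw [ENNReal.toReal_ofReal', ENNReal.toReal_ofReal'] at h3
  simp only [Pi.neg_apply, Pi.zero_apply] at h3 ⊢
  rcases le_total (g x) 0 with h4 | h4
  · rw [max_eq_right h4, max_eq_left (by linarith)] at h3; linarith
  · rw [max_eq_left h4, max_eq_right (by linarith)] at h3; linarith

end Cb2

/-! ### Closable operators from a semiboundedness estimate -/

section Hilbert

variable {E : Type*} [NormedAddCommGroup E] [InnerProductSpace ℝ E]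

/-- Semiboundedness `⟪f, Af⟫ ≤ b‖f‖²` gives dissipativity of `A - b`. -/
lemma mul_norm_le_of_inner_le {b : ℝ} {f g : E} (h : ⟪f, g⟫_ℝ ≤ b * ‖f‖ ^ 2) (l : ℝ) :
    l * ‖f‖ ≤ ‖(l + b) • f - g‖ := by
  rcases eq_or_ne f 0 with rfl | hf
  · simp
  have h1 : l * ‖f‖ ^ 2 ≤ ⟪f, (l + b) • f - g⟫_ℝ := by
    rw [inner_sub_right, real_inner_smul_right, real_inner_self_eq_norm_sq]
    linarith
  have h2 := h1.trans (real_inner_le_norm _ _)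
  have h3 : 0 < ‖f‖ := norm_pos_iff.2 hf
  refine le_of_mul_le_mul_left ?_ h3
  linarith

/-- If `⟪f, g⟫ ≤ b‖f‖²` on a linear relation whose domain has trivial orthogonal complement, then
the closure of the relation is single valued. The estimate extends to the closure, and applied to
`(f, g + s • g₀)` with `s ∈ ℝ` arbitrary it forces `g₀ ⊥ f`. -/
lemma eq_zero_of_mem_closure_of_inner_le {G : Submodule ℝ (E × E)} {b : ℝ}
    (hG : ∀ p ∈ G, ⟪p.1, p.2⟫_ℝ ≤ b * ‖p.1‖ ^ 2)
    (hperp : ∀ g : E, (∀ p ∈ G, ⟪p.1, g⟫_ℝ = 0) → g = 0)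
    {p : E × E} (hp : p ∈ G.topologicalClosure) (hp1 : p.1 = 0) : p.2 = 0 := by
  have hcl : IsClosed {p : E × E | ⟪p.1, p.2⟫_ℝ ≤ b * ‖p.1‖ ^ 2} :=
    isClosed_le (by fun_prop) (by fun_prop)
  have hG' : ∀ q ∈ G.topologicalClosure, ⟪q.1, q.2⟫_ℝ ≤ b * ‖q.1‖ ^ 2 := fun q hq =>
    closure_minimal (s := (G : Set (E × E))) hG hcl hq
  refine hperp _ fun q hq => ?_
  have hs : ∀ s : ℝ, ⟪q.1, q.2⟫_ℝ + s * ⟪q.1, p.2⟫_ℝ ≤ b * ‖q.1‖ ^ 2 := fun s => by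
    have := hG' (q + s • p)
      (add_mem (G.le_topologicalClosure hq) (G.topologicalClosure.smul_mem s hp))
    simpa [hp1, inner_add_right, real_inner_smul_right] using this
  by_contra hne
  have := hs ((b * ‖q.1‖ ^ 2 - ⟪q.1, q.2⟫_ℝ + 1) / ⟪q.1, p.2⟫_ℝ)
  rw [div_mul_cancel₀ _ hne] at this
  linarith

/-- A linear relation as in `eq_zero_of_mem_closure_of_inner_le` is the graph of a closable
operator. -/
lemma exists_isClosable_graph_eq {G : Submodule ℝ (E × E)} {b : ℝ}
    (hG : ∀ p ∈ G, ⟪p.1, p.2⟫_ℝ ≤ b * ‖p.1‖ ^ 2)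
    (hperp : ∀ g : E, (∀ p ∈ G, ⟪p.1, g⟫_ℝ = 0) → g = 0) :
    ∃ T : E →ₗ.[ℝ] E, T.graph = G ∧ T.IsClosable := by
  have h := fun p hp => eq_zero_of_mem_closure_of_inner_le hG hperp (p := p) hp
  have hgr := G.toLinearPMap_graph_eq fun p hp => h p (G.le_topologicalClosure hp)
  refine ⟨G.toLinearPMap, hgr, G.topologicalClosure.toLinearPMap, ?_⟩
  rw [hgr, Submodule.toLinearPMap_graph_eq _ h]

end Hilbert

/-! ### Measurability of `x ↦ Ψ(x)` -/

section Psi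

variable {d : ℕ} {D : BoundedOpen d}

instance {F : Type} [NormedAddCommGroup F] [SecondCountableTopology F] :
    SecondCountableTopology (Lp F 2 D.vol) :=
  haveI : Fact ((2 : ℝ≥0∞) ≠ ∞) := ⟨by simp⟩
  inferInstance

variable [NeZero d]

lemma H01.isometry_grad : Isometry (H01.grad : H01 D → L2Vec D) :=
  Isometry.of_dist_eq fun u v => by
    rw [dist_eq_norm, dist_eq_norm, H01.norm_eq]
    rfl

instance : SecondCountableTopology (H01 D) :=
  H01.isometry_grad.isEmbedding.isInducing.secondCountableTopology

instance : SecondCountableTopology (Hm1 D) :=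
  (InnerProductSpace.toDual ℝ (H01 D)).symm.isometry.isEmbedding.isInducing.secondCountableTopology

lemma continuous_ofL2 : Continuous (ofL2 : L2 D → Hm1 D) :=
  (innerSL ℝ : L2 D →L[ℝ] L2 D →L[ℝ] ℝ).continuous.clm_comp continuous_const

lemma continuous_lap : Continuous (lap : H01 D → Hm1 D) :=
  (InnerProductSpace.toDual ℝ (H01 D)).continuous.neg

lemma norm_lap (u : H01 D) : ‖lap u‖ = ‖u‖ :=
  (norm_neg (InnerProductSpace.toDual ℝ (H01 D) u)).trans (LinearIsometryEquiv.norm_map _ u)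

/-- The pairs `(f, u) ∈ L²(D) × H¹₀(D)` with `u = Ψ(f)`. -/
def psiGraph (D : BoundedOpen d) (Ψ : ℝ → ℝ) : Set (L2 D × H01 D) :=
  {p | p.2.fn =ᵐ[D.vol] fun ξ => Ψ (p.1 ξ)}

/-- Along a subsequence, `L²` convergence is almost everywhere convergence. -/
lemma isClosed_psiGraph {Ψ : ℝ → ℝ} (hΨ : Continuous Ψ) : IsClosed (psiGraph D Ψ) := by
  refine isSeqClosed_iff_isClosed.1 fun s p hs hp => ?_
  have hf : Filter.Tendsto (fun n => (s n).1) Filter.atTop (nhds p.1) :=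
    (continuous_fst.tendsto p).comp hp
  have hu : Filter.Tendsto (fun n => (s n).2.fn) Filter.atTop (nhds p.2.fn) :=
    (((H01.fnCLM D).continuous.comp continuous_snd).tendsto p).comp hp
  obtain ⟨a, ha, hfa⟩ := (tendstoInMeasure_of_tendsto_Lp hf).exists_seq_tendsto_ae
  obtain ⟨b, hb, hub⟩ := (tendstoInMeasure_of_tendsto_Lp
    (hu.comp ha.tendsto_atTop)).exists_seq_tendsto_ae
  have hall : ∀ᵐ ξ ∂D.vol, ∀ n, (s n).2.fn ξ = Ψ ((s n).1 ξ) := ae_all_iff.2 hs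
  filter_upwards [hfa, hub, hall] with ξ h1 h2 h3
  refine tendsto_nhds_unique h2 ?_
  simp only [Function.comp_apply, h3]
  exact (hΨ.tendsto _).comp (h1.comp hb.tendsto_atTop)

/-- By the Lusin–Souslin theorem the inverse of the continuous injection `(f, Ψ(f)) ↦ f` of
`psiGraph D Ψ` into `H⁻¹(D)` is Borel on its range `H_Ψ`. So `x ↦ Ψ(x)` agrees with a Borel map
on `H_Ψ`. -/
lemma exists_measurable_eq_psi {Ψ : ℝ → ℝ} (hΨ : Continuous Ψ) [MeasurableSpace (H01 D)]
    [BorelSpace (H01 D)] :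
    ∃ w : Hm1 D → H01 D, Measurable w ∧ ∀ x ∈ HPsi D Ψ, psi Ψ x = w x := by
  have : PolishSpace (psiGraph D Ψ) := (isClosed_psiGraph hΨ).polishSpace
  let _ : MeasurableSpace (psiGraph D Ψ) := borel _
  have : BorelSpace (psiGraph D Ψ) := ⟨rfl⟩
  have hc : Continuous fun p : psiGraph D Ψ => (ofL2 p.1.1 : Hm1 D) :=
    continuous_ofL2.comp (continuous_fst.comp continuous_subtype_val)
  have hi : Function.Injective fun p : psiGraph D Ψ => (ofL2 p.1.1 : Hm1 D) := by
    rintro ⟨⟨f, u⟩, hu⟩ ⟨⟨g, v⟩, hv⟩ hfg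
    obtain rfl : u = v := IsPsi.unique (x := ofL2 f) ⟨f, rfl, hu⟩ ⟨g, hfg.symm, hv⟩
    obtain rfl : f = g := ofL2_injective hfg
    rfl
  obtain ⟨w, hw, hwe⟩ := (hc.measurableEmbedding hi).exists_measurable_extend
    (g := fun p : psiGraph D Ψ => p.1.2) (continuous_snd.comp continuous_subtype_val).measurable
    fun _ => ⟨0⟩
  refine ⟨w, hw, ?_⟩
  rintro x ⟨u, hu⟩
  rw [psi_eq hu]
  obtain ⟨f, rfl, hf⟩ := hu
  exact (congrFun hwe ⟨(f, u), hf⟩).symm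

end Psi

/-! ### Kolmogorov operators with square integrable drift -/

section Kolmogorov

variable {H : Type*} [NormedAddCommGroup H] [NormedSpace ℝ H] {lam : ℕ → ℝ} {v : ℕ → H}
  {b : H → H} {φ χ : H → ℝ}

/-- The Kolmogorov operator `φ ↦ ½ ∑ₖ λₖ D²φ(vₖ, vₖ) + Dφ(b)` with drift `b` on a normed space.
`N₀` is the case `vₖ = eₖ`, `b = ΔΨ`. -/
noncomputable def kolmogorov (lam : ℕ → ℝ) (v : ℕ → H) (b : H → H) (φ : H → ℝ) (x : H) : ℝ :=
  1 / 2 * ∑' k, lam k * fderiv ℝ (fderiv ℝ φ) x (v k) (v k) + fderiv ℝ φ x (b x)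

lemma norm_trace_term_le (hlam : ∀ k, 0 ≤ lam k) (hv : ∀ k, ‖v k‖ = 1) {M : ℝ} {x : H}
    (hM : ‖fderiv ℝ (fderiv ℝ φ) x‖ ≤ M) (k : ℕ) :
    ‖lam k * fderiv ℝ (fderiv ℝ φ) x (v k) (v k)‖ ≤ lam k * M := by
  rw [norm_mul, Real.norm_of_nonneg (hlam k)]
  refine mul_le_mul_of_nonneg_left (le_trans ?_ hM) (hlam k)
  simpa [hv k] using (fderiv ℝ (fderiv ℝ φ) x).le_opNorm₂ (v k) (v k)

lemma IsCb2.summable_trace (h : IsCb2 φ) (hlam : ∀ k, 0 ≤ lam k) (hv : ∀ k, ‖v k‖ = 1)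
    (hs : Summable lam) (x : H) :
    Summable fun k => lam k * fderiv ℝ (fderiv ℝ φ) x (v k) (v k) := by
  obtain ⟨M, hM⟩ := h.bounded
  exact .of_norm_bounded (hs.mul_right M) (norm_trace_term_le hlam hv (hM x).2.2)

lemma kolmogorov_zero : kolmogorov lam v b 0 = 0 := by
  funext x
  simp [kolmogorov, fderiv_zero]

lemma kolmogorov_add (h : IsCb2 φ) (k : IsCb2 χ) (hlam : ∀ k, 0 ≤ lam k) (hv : ∀ k, ‖v k‖ = 1)
    (hs : Summable lam) :
    kolmogorov lam v b (φ + χ) = kolmogorov lam v b φ + kolmogorov lam v b χ := by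
  funext x
  rw [kolmogorov, h.fderiv_fderiv_add k, h.fderiv_add k]
  simp only [kolmogorov, Pi.add_apply, add_apply, mul_add]
  rw [(h.summable_trace hlam hv hs x).tsum_add (k.summable_trace hlam hv hs x)]
  ring

lemma kolmogorov_smul (h : IsCb2 φ) (a : ℝ) :
    kolmogorov lam v b (a • φ) = a • kolmogorov lam v b φ := by
  funext x
  rw [kolmogorov, h.fderiv_fderiv_smul, h.fderiv_smul]
  simp only [kolmogorov, Pi.smul_apply, smul_apply, smul_eq_mul, mul_left_comm _ a, tsum_mul_left]
  ring

/-- The carré du champ is nonnegative: `N(φ²) = 2φ Nφ + ∑ₖ λₖ (Dφ(vₖ))²`. -/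
lemma two_mul_mul_kolmogorov_le (h : IsCb2 φ) (hlam : ∀ k, 0 ≤ lam k) (hv : ∀ k, ‖v k‖ = 1)
    (hs : Summable lam) (x : H) :
    2 * (φ x * kolmogorov lam v b φ x) ≤ kolmogorov lam v b (φ ^ 2) x := by
  have h1 : ∀ k, 2 * φ x * (lam k * fderiv ℝ (fderiv ℝ φ) x (v k) (v k))
      ≤ lam k * fderiv ℝ (fderiv ℝ (φ ^ 2)) x (v k) (v k) := fun k => by
    rw [h.fderiv_fderiv_sq]
    simp only [add_apply, smul_apply, ContinuousLinearMap.smulRight_apply, smul_eq_mul]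
    have := mul_nonneg (hlam k) (mul_self_nonneg (fderiv ℝ φ x (v k)))
    linarith
  have h2 := ((h.summable_trace hlam hv hs x).mul_left (2 * φ x)).tsum_le_tsum h1
    (h.sq.summable_trace hlam hv hs x)
  rw [tsum_mul_left] at h2
  have h3 : fderiv ℝ (φ ^ 2) x (b x) = 2 * φ x * fderiv ℝ φ x (b x) := by
    rw [h.fderiv_sq]; rfl
  simp only [kolmogorov, h3]
  linarith

variable [MeasurableSpace H] [BorelSpace H] {ν : Measure H} {c : ℝ}

lemma aestronglyMeasurable_kolmogorov (h : IsCb2 φ) (hb : AEStronglyMeasurable b ν)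
    (hlam : ∀ k, 0 ≤ lam k) (hv : ∀ k, ‖v k‖ = 1) (hs : Summable lam)
    [SecondCountableTopology H] : AEStronglyMeasurable (kolmogorov lam v b φ) ν := by
  obtain ⟨M, hM⟩ := h.bounded
  have htr : Continuous fun x => ∑' k, lam k * fderiv ℝ (fderiv ℝ φ) x (v k) (v k) :=
    continuous_tsum (fun k => continuous_const.mul
      ((h.continuous_fderiv_fderiv.clm_apply continuous_const).clm_apply continuous_const))
      (hs.mul_right M) fun k x => norm_trace_term_le hlam hv (hM x).2.2 k
  have hdr : AEStronglyMeasurable (fun x => fderiv ℝ φ x (b x)) ν :=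
    isBoundedBilinearMap_apply.continuous.comp_aestronglyMeasurable
      (h.contDiff_fderiv.continuous.aestronglyMeasurable.prodMk hb)
  exact (continuous_const.mul htr).aestronglyMeasurable.add hdr

lemma memLp_kolmogorov [SecondCountableTopology H] [IsFiniteMeasure ν] (hb : MemLp b 2 ν)
    (hlam : ∀ k, 0 ≤ lam k) (hv : ∀ k, ‖v k‖ = 1) (hs : Summable lam) (h : IsCb2 φ) :
    MemLp (kolmogorov lam v b φ) 2 ν := by
  obtain ⟨M, hM⟩ := h.bounded
  refine ((hb.norm.const_mul M).add (memLp_const (1 / 2 * ∑' k, lam k * M))).mono'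
    (aestronglyMeasurable_kolmogorov h hb.1 hlam hv hs) (.of_forall fun x => ?_)
  have h1 : ‖∑' k, lam k * fderiv ℝ (fderiv ℝ φ) x (v k) (v k)‖ ≤ ∑' k, lam k * M :=
    tsum_of_norm_bounded (hs.mul_right M).hasSum (norm_trace_term_le hlam hv (hM x).2.2)
  have h2 : ‖fderiv ℝ φ x (b x)‖ ≤ M * ‖b x‖ :=
    (fderiv ℝ φ x).le_of_opNorm_le (hM x).2.1 _
  refine (norm_add_le _ _).trans ?_
  rw [norm_mul, Real.norm_of_nonneg (by norm_num : (0 : ℝ) ≤ 1 / 2)]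
  simp only [Pi.add_apply]
  linarith

/-- For an infinitesimally excessive `ν`, the inequality `∫ N(φ²) dν ≤ c ∫ φ² dν` and the carré du
champ bound the quadratic form of `N` by `c / 2`. -/
lemma integral_mul_kolmogorov_le [SecondCountableTopology H] [IsFiniteMeasure ν]
    (hb : MemLp b 2 ν) (hlam : ∀ k, 0 ≤ lam k) (hv : ∀ k, ‖v k‖ = 1) (hs : Summable lam)
    (hc : ∀ φ : H → ℝ, IsCb2 φ → (∀ᵐ x ∂ν, 0 ≤ φ x) →
      ∫ x, kolmogorov lam v b φ x ∂ν ≤ c * ∫ x, φ x ∂ν) (h : IsCb2 φ) :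
    ∫ x, φ x * kolmogorov lam v b φ x ∂ν ≤ 1 / 2 * c * ∫ x, φ x ^ 2 ∂ν := by
  have h1 := hc (φ ^ 2) h.sq (.of_forall fun x => sq_nonneg (φ x))
  have h2 : ∫ x, 2 * (φ x * kolmogorov lam v b φ x) ∂ν ≤ ∫ x, kolmogorov lam v b (φ ^ 2) x ∂ν :=
    integral_mono (((h.memLp ν).integrable_mul (memLp_kolmogorov hb hlam hv hs h)).const_mul 2)
      ((memLp_kolmogorov hb hlam hv hs h.sq).integrable (by norm_num))
      (two_mul_mul_kolmogorov_le h hlam hv hs)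
  rw [integral_const_mul] at h2
  simp only [Pi.pow_apply] at h1
  linarith

lemma inner_le_of_ae_eq_kolmogorov [SecondCountableTopology H] [IsFiniteMeasure ν]
    (hb : MemLp b 2 ν) (hlam : ∀ k, 0 ≤ lam k) (hv : ∀ k, ‖v k‖ = 1) (hs : Summable lam)
    (hc : ∀ φ : H → ℝ, IsCb2 φ → (∀ᵐ x ∂ν, 0 ≤ φ x) →
      ∫ x, kolmogorov lam v b φ x ∂ν ≤ c * ∫ x, φ x ∂ν) (h : IsCb2 φ) {f g : Lp ℝ 2 ν}
    (hf : f =ᵐ[ν] φ) (hg : g =ᵐ[ν] kolmogorov lam v b φ) :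
    ⟪f, g⟫_ℝ ≤ 1 / 2 * c * ‖f‖ ^ 2 := by
  have h1 : ∫ x, ⟪f x, g x⟫_ℝ ∂ν = ∫ x, φ x * kolmogorov lam v b φ x ∂ν := by
    refine integral_congr_ae ?_
    filter_upwards [hf, hg] with x h1 h2
    rw [h1, h2]
    exact mul_comm _ _
  have h2 : ∫ x, ⟪f x, f x⟫_ℝ ∂ν = ∫ x, φ x ^ 2 ∂ν := by
    refine integral_congr_ae ?_
    filter_upwards [hf] with x h1
    rw [h1]
    exact (sq _).symm
  rw [← real_inner_self_eq_norm_sq, L2.inner_def, L2.inner_def, h1, h2]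
  exact integral_mul_kolmogorov_le hb hlam hv hs hc h

lemma ofReal_mul_eLpNorm_le_kolmogorov [SecondCountableTopology H] [IsFiniteMeasure ν]
    (hb : MemLp b 2 ν) (hlam : ∀ k, 0 ≤ lam k) (hv : ∀ k, ‖v k‖ = 1) (hs : Summable lam)
    (hc : ∀ φ : H → ℝ, IsCb2 φ → (∀ᵐ x ∂ν, 0 ≤ φ x) →
      ∫ x, kolmogorov lam v b φ x ∂ν ≤ c * ∫ x, φ x ∂ν) (h : IsCb2 φ) {l : ℝ} (hl : 0 < l) :
    ENNReal.ofReal l * eLpNorm φ 2 ν ≤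
      eLpNorm (fun x => (l + 1 / 2 * c) * φ x - kolmogorov lam v b φ x) 2 ν := by
  have hφ := h.memLp ν
  have hN := memLp_kolmogorov hb hlam hv hs h
  have h1 := mul_norm_le_of_inner_le (inner_le_of_ae_eq_kolmogorov hb hlam hv hs hc h
    hφ.coeFn_toLp hN.coeFn_toLp) l
  rw [← MemLp.toLp_const_smul, ← MemLp.toLp_sub, Lp.norm_toLp, Lp.norm_toLp] at h1
  have h2 := ENNReal.ofReal_le_ofReal h1
  rwa [ENNReal.ofReal_mul hl.le, ENNReal.ofReal_toReal hφ.2.ne, ENNReal.ofReal_toReal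
    ((hφ.const_smul (l + 1 / 2 * c)).sub hN).2.ne] at h2

/-- The graph of a Kolmogorov operator in `L²(ν) × L²(ν)`: the pairs of classes of `φ` and `Nφ`,
`φ ∈ C²_b`. A priori it is only a linear relation. -/
def kolmogorovGraph (b : H → H) (ν : Measure H) (hlam : ∀ k, 0 ≤ lam k) (hv : ∀ k, ‖v k‖ = 1)
    (hs : Summable lam) : Submodule ℝ (Lp ℝ 2 ν × Lp ℝ 2 ν) where
  carrier := {p | ∃ φ : H → ℝ, IsCb2 φ ∧ p.1 =ᵐ[ν] φ ∧ p.2 =ᵐ[ν] kolmogorov lam v b φ}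
  zero_mem' := ⟨0, .zero, Lp.coeFn_zero _ _ _, by
    rw [kolmogorov_zero]; exact Lp.coeFn_zero _ _ _⟩
  add_mem' := by
    rintro p q ⟨φ, h, h1, h2⟩ ⟨χ, k, k1, k2⟩
    refine ⟨φ + χ, h.add k, (Lp.coeFn_add _ _).trans (h1.add k1), ?_⟩
    rw [kolmogorov_add h k hlam hv hs]
    exact (Lp.coeFn_add _ _).trans (h2.add k2)
  smul_mem' := by
    rintro a p ⟨φ, h, h1, h2⟩
    refine ⟨a • φ, h.smul a, (Lp.coeFn_smul _ _).trans (h1.const_smul a), ?_⟩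
    rw [kolmogorov_smul h a]
    exact (Lp.coeFn_smul _ _).trans (h2.const_smul a)

lemma exists_isClosable_kolmogorov [CompleteSpace H] [SecondCountableTopology H]
    [IsFiniteMeasure ν] (hb : MemLp b 2 ν) (hlam : ∀ k, 0 ≤ lam k) (hv : ∀ k, ‖v k‖ = 1)
    (hs : Summable lam) (hc : ∀ φ : H → ℝ, IsCb2 φ → (∀ᵐ x ∂ν, 0 ≤ φ x) →
      ∫ x, kolmogorov lam v b φ x ∂ν ≤ c * ∫ x, φ x ∂ν) :
    ∃ T : Lp ℝ 2 ν →ₗ.[ℝ] Lp ℝ 2 ν,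
      (∀ f g : Lp ℝ 2 ν, (f, g) ∈ T.graph ↔
        ∃ φ : H → ℝ, IsCb2 φ ∧ f =ᵐ[ν] φ ∧ g =ᵐ[ν] kolmogorov lam v b φ) ∧
      T.IsClosable := by
  obtain ⟨T, hT, hcl⟩ := exists_isClosable_graph_eq (G := kolmogorovGraph b ν hlam hv hs)
    (b := 1 / 2 * c)
    (fun p ⟨φ, h, h1, h2⟩ => inner_le_of_ae_eq_kolmogorov hb hlam hv hs hc h h1 h2)
    fun g hg => by
      refine (Lp.eq_zero_iff_ae_eq_zero).2 (ae_eq_zero_of_integral_mul_Cb2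
        ((Lp.memLp g).integrable (by norm_num)) fun φ h => ?_)
      have hN := memLp_kolmogorov hb hlam hv hs h
      have h0 := hg ((h.memLp ν).toLp, hN.toLp) ⟨φ, h, (h.memLp ν).coeFn_toLp, hN.coeFn_toLp⟩
      rw [L2.inner_def] at h0
      rw [← h0]
      refine integral_congr_ae ?_
      filter_upwards [(h.memLp ν).coeFn_toLp] with x hx
      rw [hx]
      exact mul_comm _ _
  exact ⟨T, fun f g => by rw [hT]; rfl, hcl⟩

end Kolmogorov

/-! ### The drift `ΔΨ` of the porous medium equation -/

section Drift

variable {d : ℕ} [NeZero d] {D : BoundedOpen d} {Ψ : ℝ → ℝ} {e : ℕ → H01 D} {lam : ℕ → ℝ}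
  {ν : Measure (Hm1 D)} {c : ℝ}

lemma N0_eq_kolmogorov (Ψ : ℝ → ℝ) (e : ℕ → H01 D) (lam : ℕ → ℝ) :
    N0 Ψ e lam = kolmogorov lam (fun k => (ofL2 (e k).fn : Hm1 D)) fun x => lap (psi Ψ x) := rfl

lemma enorm_sq_eq_lintegral_grad (u : H01 D) :
    ‖u‖ₑ ^ 2 = ∫⁻ ξ in D.carrier, ‖u.grad ξ‖ₑ ^ 2 := by
  have h := eLpNorm_nnreal_pow_eq_lintegral (μ := D.vol) (f := u.grad) (p := 2) (by norm_num)
  rw [enorm_eq_iff_norm_eq.2 (H01.norm_eq u), Lp.enorm_def]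
  have h2 : eLpNorm u.grad 2 D.vol ^ 2 = ∫⁻ ξ, ‖u.grad ξ‖ₑ ^ 2 ∂D.vol := by simpa using h
  exact h2

/-- The energy condition on `ν` says that `ΔΨ` is square integrable. -/
lemma IsExcessive.memLp_lap_psi (hν : IsExcessive Ψ e lam ν c) (hΨ : Continuous Ψ) :
    MemLp (fun x => lap (psi Ψ x)) 2 ν := by
  let _ : MeasurableSpace (H01 D) := borel _
  have : BorelSpace (H01 D) := ⟨rfl⟩
  obtain ⟨w, hw, hwe⟩ := exists_measurable_eq_psi (D := D) hΨ
  have hm : AEMeasurable (fun x => lap (psi Ψ x)) ν := by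
    refine ⟨_, continuous_lap.measurable.comp hw, ?_⟩
    filter_upwards [hν.ae_mem] with x hx
    rw [hwe x hx, Function.comp_apply]
  refine ⟨hm.aestronglyMeasurable, ?_⟩
  rw [eLpNorm_lt_top_iff_lintegral_rpow_enorm_lt_top (by norm_num) (by norm_num)]
  convert hν.energy using 3 with x
  rw [← enorm_sq_eq_lintegral_grad, enorm_eq_iff_norm_eq.2 (norm_lap (psi Ψ x))]
  norm_num

end Drift

end PorousMedia

open PorousMedia in
theorem proposition2p4 {d : ℕ} [NeZero d] (D : BoundedOpen d)
    -- the noise: a positive trace class operator, diagonal in an eigenbasis of the Laplacian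
    (C : Hm1 D →L[ℝ] Hm1 D) (hC : ContinuousLinearMap.IsPositive (𝕜 := ℝ) (E := Hm1 D) C)
    (e : ℕ → H01 D) (he : IsEigenbasis e)
    (hCtr : Summable fun k => ⟪C (ofL2 (e k).fn), ofL2 (e k).fn⟫_ℝ)
    (lam : ℕ → ℝ) (hlam : ∀ k, 0 ≤ lam k) (hCe : ∀ k, C (ofL2 (e k).fn) = lam k • ofL2 (e k).fn)
    (hsup : ∑' k, supSq (e k) * ENNReal.ofReal (lam k) < ⊤)
    -- the nonlinearity
    (Ψ : ℝ → ℝ) (hΨ : IsPorousNonlinearity Ψ)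
    -- the infinitesimally excessive measure and its constant
    (ν : Measure (Hm1 D)) (c : ℝ) (hν : IsExcessive Ψ e lam ν c) :
    -- square integrability
    (∀ φ : Hm1 D → ℝ, IsCb2 φ → MemLp (N0 Ψ e lam φ) 2 ν) ∧
    -- dissipativity
    (∀ φ : Hm1 D → ℝ, IsCb2 φ → ∀ l : ℝ, 0 < l →
      ENNReal.ofReal l * eLpNorm φ 2 ν ≤
        eLpNorm (fun x => (l + 1 / 2 * c) * φ x - N0 Ψ e lam φ x) 2 ν) ∧
    -- the operator on `L²(H, ν)`, defined on the classes of functions in `C²_b(H)`, is closable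
    (∃ T : Lp ℝ 2 ν →ₗ.[ℝ] Lp ℝ 2 ν,
      (∀ f g : Lp ℝ 2 ν, (f, g) ∈ T.graph ↔
        ∃ φ : Hm1 D → ℝ, IsCb2 φ ∧ f =ᵐ[ν] φ ∧ g =ᵐ[ν] N0 Ψ e lam φ) ∧
      T.IsClosable) := by
  -- the trace of `C` is the sum of its eigenvalues
  have hs : Summable lam := by
    refine hCtr.congr fun k => ?_
    have h1 : ⟪(ofL2 (e k).fn : Hm1 D), ofL2 (e k).fn⟫_ℝ = 1 := by
      rw [real_inner_self_eq_norm_sq, he.orthonormal.1, one_pow]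
    have h2 := real_inner_smul_left (ofL2 (e k).fn : Hm1 D) (ofL2 (e k).fn) (lam k)
    rw [h1, mul_one] at h2
    rw [hCe]
    exact h2
  have := hν.isProbabilityMeasure
  have hb := hν.memLp_lap_psi hΨ.1.continuous
  have hv : ∀ k, ‖(ofL2 (e k).fn : Hm1 D)‖ = 1 := he.orthonormal.1
  have hc := hν.excessive
  rw [N0_eq_kolmogorov] at hc ⊢
  refine ⟨?_, ?_, ?_⟩
  · exact fun φ h => memLp_kolmogorov hb hlam hv hs h
  · exact fun φ h l hl => ofReal_mul_eLpNorm_le_kolmogorov hb hlam hv hs hc h hl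
  · exact exists_isClosable_kolmogorov hb hlam hv hs hc
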